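/- Let $k$ be an algebraically closed field of characteristic $0$, let $X$ be a K3 surface over $k$ (a smooth proper geometrically integral surface with $\omega_X\cong\mathcal O_X$ and $H^1(X,\mathcal O_X)=0$), and let $\pi\colon X\to\mathbb P^1_k$ be a genus $1$ fibration, i.e. a $k$-morphism whose generic fibre $X_{k(u)}:=X\times_{\mathbb P^1_k}\operatorname{Spec}k(u)$ is a smooth, proper, geometrically integral curve of genus $1$ over $k(u)$, where $u$ is the affine coordinate of $\mathbb P^1_k$. A curve over a field is a reduced separated scheme of finite type and of dimension $1$; a curve $C$ over an extension field $L$ of $k$ is called constant over $k$ if there is a curve $C_0$ over $k$ with $C\cong C_0\otimes_k L$ over $L$. Then for every rational extension $k(t)/k(u)$, i.e. every $k$-embedding $k(u)\hookrightarrow k(t)$ into a rational function field in one variable, the base change $X_{k(t)}:=X_{k(u)}\otimes_{k(u)}k(t)$ is a curve over $k(t)$ that is not constant over $k$. -/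

import Mathlib

open CategoryTheory AlgebraicGeometry TopologicalSpace Limits
open scoped KaehlerDifferential

universe u

noncomputable section

namespace K3Fib

/-! ### Sections of the structure sheaf as algebras over the ground field -/

/-- The ring `Γ(X, U)`, regarded as an algebra over `K` through `f : X ⟶ Spec K`. -/
def Sec {K : Type u} [Field K] {X : Scheme.{u}} (_f : X ⟶ Spec (.of K)) (U : X.Opens) : Type u :=
  Γ(X, U)

section Sec

variable {K : Type u} [Field K] {X : Scheme.{u}} (f : X ⟶ Spec (.of K))

instance (U : X.Opens) : CommRing (Sec f U) := inferInstanceAs (CommRing Γ(X, U))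

/-- The ring homomorphism `K → Γ(X, U)` induced by `f : X ⟶ Spec K`. -/
def scalar (U : X.Opens) : K →+* Sec f U :=
  ((Scheme.ΓSpecIso (.of K)).inv ≫ f.appTop ≫ X.presheaf.map (homOfLE le_top : U ⟶ ⊤).op).hom

instance (U : X.Opens) : Algebra K (Sec f U) := (scalar f U).toAlgebra

/-- Restriction of functions to a smaller open set, as a homomorphism of `K`-algebras. -/
def res {U V : X.Opens} (h : V ≤ U) : Sec f U →ₐ[K] Sec f V where
  __ := (X.presheaf.map (homOfLE h).op).hom
  commutes' r := by
    have e : X.presheaf.map (homOfLE le_top : U ⟶ ⊤).op ≫ X.presheaf.map (homOfLE h).op =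
        X.presheaf.map (homOfLE le_top : V ⟶ ⊤).op := (X.presheaf.map_comp _ _).symm
    exact ConcreteCategory.congr_hom e
      (((Scheme.ΓSpecIso (.of K)).inv ≫ f.appTop).hom r)

/-! ### Cohomology of the structure sheaf -/

/-- The structure sheaf `𝒪_X` as a presheaf of `K`-modules. -/
def structurePresheaf : (Opens X)ᵒᵖ ⥤ ModuleCat.{u} K where
  obj U := ModuleCat.of K (Sec f U.unop)
  map i := ModuleCat.ofHom (res f i.unop.le).toLinearMap
  map_id U := by
    ext x
    exact ConcreteCategory.congr_hom (X.presheaf.map_id U) x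
  map_comp i j := by
    ext x
    exact ConcreteCategory.congr_hom (X.presheaf.map_comp i j) x

/-- The structure sheaf `𝒪_X` as a sheaf of `K`-modules on the Zariski site of `X`. -/
def structureSheaf : Sheaf (Opens.grothendieckTopology X) (ModuleCat.{u} K) :=
  ⟨structurePresheaf f, by
    rw [Presheaf.isSheaf_iff_isSheaf_forget _ _ (forget (ModuleCat.{u} K))]
    exact (Presheaf.isSheaf_iff_isSheaf_forget _ _ (forget CommRingCat.{u})).mp X.sheaf.2⟩

/-- Sheaf cohomology `Hⁿ(X, 𝒪_X)`: the derived functor of global sections, that is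
`Extⁿ(K_X, 𝒪_X)` in the category of sheaves of `K`-modules, `K_X` being the constant sheaf. -/
abbrev cohomology (n : ℕ) : Type u :=
  Abelian.Ext ((constantSheaf (Opens.grothendieckTopology X) (ModuleCat.{u} K)).obj
    (ModuleCat.of K K)) (structureSheaf f) n

end Sec

/-! ### Differential forms -/

/-- The map `⋀ᵖ Ω_{A/K} → ⋀ᵖ Ω_{B/K}` induced by a homomorphism `A → B` of `K`-algebras:
`a₀ da₁ ∧ ⋯ ∧ daₚ ↦ g(a₀) dg(a₁) ∧ ⋯ ∧ dg(aₚ)`. -/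
def formMap {K A B : Type u} [Field K] [CommRing A] [CommRing B] [Algebra K A] [Algebra K B]
    (g : A →ₐ[K] B) (p : ℕ) : (⋀[A]^p Ω[A⁄K]) →+ (⋀[B]^p Ω[B⁄K]) :=
  letI : Algebra A B := g.toRingHom.toAlgebra
  haveI : IsScalarTower K A B := IsScalarTower.of_algebraMap_eq fun r => (g.commutes r).symm
  (exteriorPower.alternatingMapLinearEquiv (R := A)
    (N := (⋀[B]^p Ω[B⁄K]))
    { toMultilinearMap :=
        ((exteriorPower.ιMulti B p (M := Ω[B⁄K])).toMultilinearMap.restrictScalars A).compLinearMap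
          fun _ => KaehlerDifferential.map K K A B
      map_eq_zero_of_eq' := fun _ _ _ h hij =>
        (exteriorPower.ιMulti B p (M := Ω[B⁄K])).map_eq_zero_of_eq _
          (congrArg (KaehlerDifferential.map K K A B) h) hij }).toAddMonoidHom

/-- The canonical bundle `⋀² Ω_{X/K}` of a smooth surface `X` over `K` is trivial: there is a global
`2`-form, given by a compatible family of sections over the affine open subsets of `X`, such that
multiplication by it is an isomorphism from `𝒪_X` to `⋀² Ω_{X/K}`. -/
def TrivialCanonicalBundle {K : Type u} [Field K] {X : Scheme.{u}} (f : X ⟶ Spec (.of K)) : Prop :=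
  ∃ ω : ∀ U : X.affineOpens, ⋀[Sec f U.1]^2 Ω[Sec f U.1⁄K],
    (∀ (U V : X.affineOpens) (h : V.1 ≤ U.1), formMap (res f h) 2 (ω U) = ω V) ∧
    ∀ U : X.affineOpens, Function.Bijective fun a : Sec f U.1 => a • ω U

/-! ### Curves and K3 surfaces -/

/-- A K3 surface over a field `k`: a smooth proper geometrically integral surface `X` with trivial
canonical bundle and `H¹(X, 𝒪_X) = 0`. -/
structure IsK3Surface {k : Type u} [Field k] {X : Scheme.{u}} (f : X ⟶ Spec (.of k)) : Prop where
  smooth : SmoothOfRelativeDimension 2 f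
  proper : IsProper f
  geometricallyIntegral : GeometricallyIntegral f
  trivialCanonicalBundle : TrivialCanonicalBundle f
  irregularity : Subsingleton (cohomology f 1)

/-- A curve over a field `K`: a reduced separated scheme of finite type over `K`, of dimension `1`. -/
structure IsCurve {K : Type u} [Field K] {C : Scheme.{u}} (c : C ⟶ Spec (.of K)) : Prop where
  reduced : IsReduced C
  separated : IsSeparated c
  locallyOfFiniteType : LocallyOfFiniteType c
  quasiCompact : QuasiCompact c
  dim_eq_one : topologicalKrullDim C = 1

/-- A smooth, proper, geometrically integral curve of genus `1` over a field `K`, the genus being the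
dimension of `H¹(C, 𝒪_C)`. -/
structure IsGenusOneCurve {K : Type u} [Field K] {C : Scheme.{u}} (c : C ⟶ Spec (.of K)) :
    Prop where
  isCurve : IsCurve c
  smooth : Smooth c
  proper : IsProper c
  geometricallyIntegral : GeometricallyIntegral c
  genus_eq_one : Module.finrank K (cohomology c 1) = 1

/-- A curve `C` over an extension `L` of `k` is constant over `k` if it is isomorphic over `L` to the
base change `C₀ ⊗_k L` of a curve `C₀` over `k`. -/
def IsConstant (k : Type u) {L : Type u} [Field k] [Field L] [Algebra k L] {C : Scheme.{u}}
    (c : C ⟶ Spec (.of L)) : Prop :=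
  ∃ (C₀ : Scheme.{u}) (c₀ : C₀ ⟶ Spec (.of k)), IsCurve c₀ ∧
    Nonempty (Over.mk c ≅
      Over.mk (pullback.snd c₀ (Spec.map (CommRingCat.ofHom (algebraMap k L)))))

/-! ### The projective line and its generic point -/

section ProjectiveLine

variable (k : Type u) [Field k]

instance : GradedAlgebra (MvPolynomial.homogeneousSubmodule (Fin 2) k) :=
  MvPolynomial.gradedAlgebra

/-- The projective line `Proj k[x₀, x₁]`. -/
abbrev P1 : Scheme.{u} := Proj (MvPolynomial.homogeneousSubmodule (Fin 2) k)

/-- The structure morphism of the projective line. -/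
def P1.toSpec : P1 k ⟶ Spec (.of k) :=
  Proj.toSpecZero (MvPolynomial.homogeneousSubmodule (Fin 2) k) ≫
    Spec.map (CommRingCat.ofHom
      (algebraMap k (MvPolynomial.homogeneousSubmodule (Fin 2) k 0)))

/-- The homomorphism from the coordinate ring of the chart `x₀ ≠ 0` of the projective line to the
field `k(u)` of rational functions, which sends the affine coordinate `x₁ / x₀` to `u`. -/
def P1.chartToRatFunc :
    HomogeneousLocalization.Away (MvPolynomial.homogeneousSubmodule (Fin 2) k)
      (MvPolynomial.X 0) →+* RatFunc k :=
  (IsLocalization.Away.lift (S := Localization.Away (MvPolynomial.X 0 : MvPolynomial (Fin 2) k))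
    (MvPolynomial.X 0)
    (g := (MvPolynomial.aeval (R := k) ![(1 : RatFunc k), RatFunc.X]).toRingHom)
    (by simp)).comp (algebraMap _ _)

/-- The inclusion `Spec k(u) ⟶ ℙ¹` of the generic point, `u = x₁ / x₀` being the affine
coordinate. -/
def P1.genericPoint : Spec (.of (RatFunc k)) ⟶ P1 k :=
  Spec.map (CommRingCat.ofHom (P1.chartToRatFunc k)) ≫
    Proj.awayι (MvPolynomial.homogeneousSubmodule (Fin 2) k) (MvPolynomial.X 0)
      ((MvPolynomial.mem_homogeneousSubmodule 1 _).mpr (MvPolynomial.isHomogeneous_X k 0)) one_pos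

end ProjectiveLine

/-! ### Genus one fibrations -/

section Fibration

variable {k : Type u} [Field k] {X : Scheme.{u}}

/-- The generic fibre `X_{k(u)}` of `π : X ⟶ ℙ¹`. -/
abbrev genericFibre (π : X ⟶ P1 k) : Scheme.{u} := pullback π (P1.genericPoint k)

/-- The structure morphism of the generic fibre `X_{k(u)}` of `π : X ⟶ ℙ¹`. -/
abbrev genericFibreToSpec (π : X ⟶ P1 k) : genericFibre π ⟶ Spec (.of (RatFunc k)) :=
  pullback.snd π (P1.genericPoint k)

/-- The morphism `π : X ⟶ ℙ¹` of `k`-schemes is a genus `1` fibration: its generic fibre is a smooth,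
proper, geometrically integral curve of genus `1` over `k(u)`. -/
structure IsGenusOneFibration (f : X ⟶ Spec (.of k)) (π : X ⟶ P1 k) : Prop where
  comp_toSpec : π ≫ P1.toSpec k = f
  generic : IsGenusOneCurve (genericFibreToSpec π)

/-- The structure morphism `X_{k(t)} ⟶ Spec k(t)` of the base change of the generic fibre of `π`
along an embedding `φ : k(u) → k(t)` over `k`. -/
abbrev genericFibreBaseChangeToSpec (π : X ⟶ P1 k) (φ : RatFunc k →ₐ[k] RatFunc k) :
    pullback (genericFibreToSpec π) (Spec.map (CommRingCat.ofHom φ.toRingHom)) ⟶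
      Spec (.of (RatFunc k)) :=
  pullback.snd (genericFibreToSpec π) (Spec.map (CommRingCat.ofHom φ.toRingHom))

end Fibration

end K3Fib

end

/-!
Suppose that `X_{k(t)}` is constant, say equal to `C ⊗ k(t)`, and let `F` be the function field of
`C`. The generic point of `C ⊗ k(t)` gives a point of `X` with values in `F(t)`, where `F` is
transcendental over `k`. By the valuative criterion of properness, the pullback of the generator `ω`
of the canonical bundle of `X` to this point is regular on every valuation ring of `F(t)`.
Evaluating it at `∂/∂t` and at the extension of a `k`-derivation `d` of `F` that annihilates `t`
gives an element of `F(t)` without poles that vanishes at infinity, hence `0`.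

Since `ω` generates the `2`-forms, the two derivations are proportional on the values at this point
of functions on `X`. On the other hand, a derivation of `F(t)` that annihilates these values is
`0`: its field of constants is algebraically closed in `F(t)`, so not only the point of `X` but also
the point of `C ⊗ k(t)` is defined over it. Hence the two derivations of `F(t)` are proportional,
and comparing them on `t` gives `d = 0`. But a transcendental extension `F` of `k` in characteristic
`0` has a nonzero derivation.
-/

noncomputable section

namespace K3Fib

/-! ### Derivations of fields -/

section Derivations

lemma exists_derivation_of_formallyEtale {R A B M : Type*} [CommRing R] [CommRing A] [CommRing B]
    [Algebra R A] [Algebra R B] [Algebra A B] [IsScalarTower R A B] [Algebra.FormallyEtale A B]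
    [AddCommGroup M] [Module R M] [Module A M] [Module B M] [IsScalarTower R A M]
    [IsScalarTower R B M] [IsScalarTower A B M] (d : Derivation R A M) :
    ∃ D : Derivation R B M, ∀ a, D (algebraMap A B a) = d a := by
  have h := KaehlerDifferential.isBaseChange_of_formallyEtale R A B
  refine ⟨(h.lift d.liftKaehlerDifferential).compDer (KaehlerDifferential.D R B), fun a => ?_⟩
  simpa using h.lift_eq d.liftKaehlerDifferential (KaehlerDifferential.D R A a)

open scoped IntermediateField.algebraAdjoinAdjoin in
lemma formallyEtale_adjoin_of_isTranscendenceBasis {k F ι : Type*} [Field k] [CharZero k] [Field F]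
    [Algebra k F] {v : ι → F} (hv : IsTranscendenceBasis k v) :
    Algebra.FormallyEtale (Algebra.adjoin k (Set.range v)) F := by
  let A := Algebra.adjoin k (Set.range v)
  let E := IntermediateField.adjoin k (Set.range v)
  have : Algebra.IsAlgebraic E F := hv.isAlgebraic_field
  have : Algebra.FormallyEtale E F := Algebra.FormallyEtale.of_isSeparable E F
  have : Algebra.FormallyEtale A E := Algebra.FormallyEtale.of_isLocalization (nonZeroDivisors A)
  exact Algebra.FormallyEtale.comp A E F

lemma exists_derivation_ne_zero {k F : Type*} [Field k] [CharZero k] [Field F] [Algebra k F]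
    [Algebra.Transcendental k F] : ∃ d : Derivation k F F, d ≠ 0 := by
  obtain ⟨s, hs⟩ := exists_isTranscendenceBasis k F
  obtain ⟨i⟩ : Nonempty s := hs.nonempty_iff_transcendental.mpr inferInstance
  have := formallyEtale_adjoin_of_isTranscendenceBasis hs
  let e := hs.1.aevalEquiv
  have he (a : Algebra.adjoin k (Set.range ((↑) : s → F))) :
      MvPolynomial.aeval ((↑) : s → F) (e.symm a) = a := by
    rw [← hs.1.algebraMap_aevalEquiv]
    exact congrArg Subtype.val (e.apply_symm_apply a)
  let d : Derivation k (Algebra.adjoin k (Set.range ((↑) : s → F))) F :=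
    Derivation.mk' ((MvPolynomial.aeval (↑)).toLinearMap ∘ₗ (MvPolynomial.pderiv i).toLinearMap ∘ₗ
      e.symm.toLinearMap) fun a b => by simp [Derivation.leibniz, he, Algebra.smul_def]
  obtain ⟨D, hD⟩ := exists_derivation_of_formallyEtale (B := F) d
  refine ⟨D, fun h0 => ?_⟩
  simpa [d, h0] using hD (e (MvPolynomial.X i))

/-- The field of constants of a derivation `D`, the field over which a point is defined as soon as
`D` annihilates the functions at this point. -/
def constants {k L M : Type*} [Field k] [Field L] [Algebra k L] [AddCommGroup M] [Module k M]
    [Module L M] (D : Derivation k L M) : IntermediateField k L where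
  carrier := {x | D x = 0}
  mul_mem' {a b} ha hb := by
    rw [Set.mem_ofPred_eq] at *
    rw [D.leibniz, ha, hb, smul_zero, smul_zero, add_zero]
  add_mem' {a b} ha hb := by
    rw [Set.mem_ofPred_eq] at *
    rw [map_add, ha, hb, add_zero]
  algebraMap_mem' := D.map_algebraMap
  inv_mem' _ ha := by
    rw [Set.mem_ofPred_eq] at *
    rw [D.leibniz_inv, ha, smul_zero]

section Constants

variable {k L M : Type*} [Field k] [Field L] [Algebra k L] [AddCommGroup M] [Module k M]
  [Module L M] {D : Derivation k L M}

lemma mem_constants {x : L} : x ∈ constants D ↔ D x = 0 := Iff.rfl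

lemma eq_zero_of_constants_eq_top (h : constants D = ⊤) : D = 0 :=
  Derivation.ext fun _ => mem_constants.mp (h ▸ IntermediateField.mem_top)

variable (D) in
lemma isIntegrallyClosedIn_constants [CharZero k] : IsIntegrallyClosedIn (constants D) L := by
  refine isIntegrallyClosedIn_iff.mpr ⟨FaithfulSMul.algebraMap_injective _ _, fun {x} hx => ?_⟩
  let : Module (constants D) M := Module.compHom M (algebraMap (constants D) L)
  let D' : Derivation (constants D) L M :=
    { D with
      map_smul' := fun e y => by
        change D (e.1 * y) = e.1 • D y
        rw [D.leibniz, mem_constants.mp e.2, smul_zero, add_zero] }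
  have h := D'.map_aeval (minpoly (constants D) x) x
  rw [minpoly.aeval, map_zero, eq_comm, smul_eq_zero] at h
  exact ⟨⟨x, h.resolve_left ((minpoly.irreducible hx).separable.aeval_derivative_ne_zero
    (minpoly.aeval _ x))⟩, rfl⟩

end Constants

lemma exists_eq_smul_of_forall_mul_eq {k A L : Type*} [CommRing k] [Field L] [Algebra k L]
    {v : A → L} (hv : ∀ D : Derivation k L L, (∀ a, D (v a) = 0) → D = 0)
    {D₁ D₂ : Derivation k L L} (hD₁ : D₁ ≠ 0)
    (h : ∀ a b, D₁ (v a) * D₂ (v b) = D₂ (v a) * D₁ (v b)) :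
    ∃ c : L, D₂ = c • D₁ := by
  obtain ⟨a, ha⟩ : ∃ a, D₁ (v a) ≠ 0 := by
    by_contra! h₀
    exact hD₁ (hv D₁ h₀)
  refine ⟨D₂ (v a) / D₁ (v a), sub_eq_zero.mp (hv _ fun b => ?_)⟩
  simp only [Derivation.sub_apply, Derivation.smul_apply, smul_eq_mul]
  field_simp
  linear_combination h a b

end Derivations

/-! ### Rational function fields in one variable -/

section RatFunc

open Polynomial

lemma finite_ratFunc_algHom {k : Type*} [Field k] (φ : RatFunc k →ₐ[k] RatFunc k) :
    φ.toRingHom.Finite := by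
  have hX : ¬ ∃ c, φ RatFunc.X = RatFunc.C c := by
    rintro ⟨c, hc⟩
    rw [← RatFunc.algebraMap_eq_C, ← φ.commutes] at hc
    exact RatFunc.transcendental_X (φ.injective hc ▸ isAlgebraic_algebraMap c)
  have hφ : φ.fieldRange = IntermediateField.adjoin k {φ RatFunc.X} := by
    rw [← Set.image_singleton, ← IntermediateField.adjoin_map, RatFunc.adjoin_X,
      AlgHom.fieldRange_eq_map]
  have : FiniteDimensional φ.fieldRange (RatFunc k) := by
    rw [hφ]
    refine FiniteDimensional.of_finrank_pos ?_
    rw [RatFunc.finrank_eq_max_natDegree]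
    by_contra h
    exact hX ((RatFunc.eq_C_iff _).mpr (by omega))
  have hfin : (algebraMap φ.fieldRange (RatFunc k)).Finite := this
  exact hfin.comp
    (RingHom.Finite.of_surjective φ.rangeRestrict.toRingHom φ.rangeRestrict_surjective)

lemma ratFunc_fieldRange_le_of_mem {k L : Type*} [Field k] [Field L] [Algebra k L]
    (E : IntermediateField k L) [IsIntegrallyClosedIn E L] (ψ : RatFunc k →ₐ[k] L) {y : RatFunc k}
    (hy : Transcendental k y) (h : ψ y ∈ E) : ψ.fieldRange ≤ E := by
  have hne : E.comap ψ ≠ ⊥ := fun hbot => hy <| by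
    obtain ⟨c, rfl⟩ := IntermediateField.mem_bot.mp (hbot ▸ show y ∈ E.comap ψ from h)
    exact isAlgebraic_algebraMap c
  have hX : IsAlgebraic E (ψ RatFunc.X) :=
    (RatFunc.IntermediateField.isAlgebraic_X hne).ringHom_of_comp_eq
      (f := ψ.toRingHom.restrict (E.comap ψ) E fun _ hx => hx) (g := ψ.toRingHom)
      (RingHom.injective _) rfl
  obtain ⟨x, hx⟩ := IsIntegrallyClosedIn.isIntegral_iff.mp hX.isIntegral
  rw [AlgHom.fieldRange_eq_map, IntermediateField.map_le_iff_le_comap, ← RatFunc.adjoin_X,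
    IntermediateField.adjoin_simple_le_iff]
  exact (hx ▸ x.2 : ψ RatFunc.X ∈ E)

lemma ratFunc_eq_top_of_mem {k F : Type*} [Field k] [Field F] [Algebra k F]
    (E : IntermediateField k (RatFunc F)) (hF : ∀ a, algebraMap F (RatFunc F) a ∈ E)
    (hX : RatFunc.X ∈ E) : E = ⊤ := by
  let E' : IntermediateField F (RatFunc F) := { E with algebraMap_mem' := hF }
  have hE' : E' = ⊤ := top_le_iff.mp <| by
    rw [← RatFunc.adjoin_X, IntermediateField.adjoin_simple_le_iff]
    exact hX
  exact top_le_iff.mp fun x _ => (hE' ▸ IntermediateField.mem_top : x ∈ E')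

lemma exists_ratFunc_algHom_X_eq_X (k F : Type*) [Field k] [Field F] [Algebra k F] :
    ∃ ψ : RatFunc k →ₐ[k] RatFunc F, ψ RatFunc.X = RatFunc.X := by
  let g := Polynomial.mapAlgHom (Algebra.ofId k F)
  have hg := nonZeroDivisors_le_comap_nonZeroDivisors_of_injective g
    (Polynomial.map_injective _ (algebraMap k F).injective)
  refine ⟨RatFunc.mapAlgHom g hg, ?_⟩
  simpa [g, RatFunc.coe_mapAlgHom_eq_coe_map] using RatFunc.map_apply_div g hg Polynomial.X 1

variable {k F : Type*} [CommRing k] [Field F] [Algebra k F]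

/-- The extension to `F(t)` of a derivation of `F[t]`. -/
def ratFuncExtension (δ : Derivation k F[X] F[X]) : Derivation k (RatFunc F) (RatFunc F) :=
  haveI := Algebra.FormallyEtale.of_isLocalization (Rₘ := RatFunc F) (nonZeroDivisors F[X])
  (exists_derivation_of_formallyEtale ((Algebra.linearMap F[X] (RatFunc F)).compDer δ)).choose

lemma ratFuncExtension_algebraMap (δ : Derivation k F[X] F[X]) (p : F[X]) :
    ratFuncExtension δ (algebraMap F[X] (RatFunc F) p) = algebraMap F[X] (RatFunc F) (δ p) :=
  haveI := Algebra.FormallyEtale.of_isLocalization (Rₘ := RatFunc F) (nonZeroDivisors F[X])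
  (exists_derivation_of_formallyEtale
    ((Algebra.linearMap F[X] (RatFunc F)).compDer δ)).choose_spec p

variable (k F) in
/-- The derivation `∂/∂t` of `F(t)`. -/
def ratFuncDeriv : Derivation k (RatFunc F) (RatFunc F) :=
  ratFuncExtension (Polynomial.derivative'.restrictScalars k)

lemma ratFuncDeriv_algebraMap (p : F[X]) :
    ratFuncDeriv k F (algebraMap F[X] (RatFunc F) p) =
      algebraMap F[X] (RatFunc F) (derivative p) :=
  ratFuncExtension_algebraMap _ p

lemma ratFuncDeriv_X : ratFuncDeriv k F RatFunc.X = 1 := by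
  rw [← RatFunc.algebraMap_X, ratFuncDeriv_algebraMap, derivative_X, map_one]

/-- The derivation of `F[t]` that applies a derivation of `F` to the coefficients. -/
def polynomialMapCoeff (d : Derivation k F F) : Derivation k F[X] F[X] :=
  PolynomialModule.equivPolynomialSelf.compDer d.mapCoeffs

lemma coeff_polynomialMapCoeff (d : Derivation k F F) (p : F[X]) (n : ℕ) :
    (polynomialMapCoeff d p).coeff n = d (p.coeff n) := rfl

lemma degree_polynomialMapCoeff_le (d : Derivation k F F) (p : F[X]) :
    (polynomialMapCoeff d p).degree ≤ p.degree := by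
  refine (degree_le_iff_coeff_zero _ _).mpr fun n hn => ?_
  rw [coeff_polynomialMapCoeff, coeff_eq_zero_of_degree_lt hn, map_zero]

/-- The derivation of `F(t)` that extends a derivation of `F` and annihilates `t`. -/
def ratFuncMapCoeff (d : Derivation k F F) : Derivation k (RatFunc F) (RatFunc F) :=
  ratFuncExtension (polynomialMapCoeff d)

lemma ratFuncMapCoeff_X (d : Derivation k F F) : ratFuncMapCoeff d RatFunc.X = 0 := by
  rw [← RatFunc.algebraMap_X, ratFuncMapCoeff, ratFuncExtension_algebraMap]
  simp [polynomialMapCoeff]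

lemma ratFuncMapCoeff_C (d : Derivation k F F) (a : F) :
    ratFuncMapCoeff d (RatFunc.C a) = RatFunc.C (d a) := by
  rw [← RatFunc.algebraMap_C, ratFuncMapCoeff, ratFuncExtension_algebraMap, ← RatFunc.algebraMap_C]
  simp [polynomialMapCoeff]

end RatFunc

/-! ### Derivations and valuations -/

section Valuations

lemma valuation_derivation_le {R A L Γ₀ : Type*} [CommRing R] [CommRing A] [IsDomain A] [Field L]
    [Algebra R L] [Algebra A L] [IsFractionRing A L] [LinearOrderedCommGroupWithZero Γ₀]
    (v : Valuation L Γ₀) (D : Derivation R L L)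
    (h : ∀ a : A, v (D (algebraMap A L a)) ≤ v (algebraMap A L a)) (x : L) : v (D x) ≤ v x := by
  obtain ⟨n, d, hd, hx⟩ := IsFractionRing.div_surjective (A := A) x
  have hd0 : algebraMap A L d ≠ 0 := IsFractionRing.to_map_ne_zero_of_mem_nonZeroDivisors hd
  replace hx : x * algebraMap A L d = algebraMap A L n := ((div_eq_iff hd0).mp hx).symm
  have hDx : D x * algebraMap A L d = D (algebraMap A L n) - x * D (algebraMap A L d) := by
    rw [← hx, D.leibniz]; simp only [smul_eq_mul]; ring
  have hv : 0 < v (algebraMap A L d) := zero_lt_iff.mpr ((map_ne_zero v).mpr hd0)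
  rw [← mul_le_mul_iff_left₀ hv, ← map_mul, ← map_mul, hDx, hx]
  refine (v.map_sub _ _).trans (max_le (h n) ?_)
  rw [← hx, map_mul, map_mul]
  gcongr
  exact h d

lemma valuation_derivation_le_one {R A L : Type*} [CommRing R] [CommRing A] [IsDedekindDomain A]
    [Field L] [Algebra R L] [Algebra A L] [IsFractionRing A L]
    (v : IsDedekindDomain.HeightOneSpectrum A) (D : Derivation R L L)
    (h : ∀ a : A, D (algebraMap A L a) ∈ (algebraMap A L).range) {x : L}
    (hx : v.valuation L x ≤ 1) : v.valuation L (D x) ≤ 1 := by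
  obtain ⟨n, d, hnd⟩ := v.exists_primeCompl_mul_eq_of_integer x hx
  have hD (a : A) : v.valuation L (D (algebraMap A L a)) ≤ 1 := by
    obtain ⟨b, hb⟩ := h a
    exact hb ▸ v.valuation_le_one b
  have hDx : D x * algebraMap A L d = D (algebraMap A L n) - x * D (algebraMap A L d) := by
    rw [← hnd, D.leibniz]; simp only [smul_eq_mul]; ring
  have hd : v.valuation L (algebraMap A L d) = 1 := by
    rw [v.valuation_of_algebraMap]
    exact (v.intValuation_eq_one_iff_mem_primeCompl _).mpr d.2
  rw [← mul_one (v.valuation L (D x)), ← hd, ← map_mul, hDx, hd]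
  refine ((v.valuation L).map_sub _ _).trans (max_le (hD n) ?_)
  rw [map_mul]
  exact mul_le_one' hx (hD d)

variable {F : Type*} [Field F] [DecidableEq (RatFunc F)]

lemma ratFunc_eq_zero_of_valuation {g : RatFunc F}
    (hfin : ∀ v : IsDedekindDomain.HeightOneSpectrum (Polynomial F), v.valuation (RatFunc F) g ≤ 1)
    (hinf : RatFunc.inftyValuation F (RatFunc.X * g) ≤ 1) : g = 0 := by
  obtain ⟨p, rfl⟩ := IsDedekindDomain.HeightOneSpectrum.mem_integers_of_valuation_le_one _ g hfin
  by_contra hp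
  have hp0 : p ≠ 0 := fun h => hp (by simp [h])
  rw [map_mul, RatFunc.inftyValuation.X, RatFunc.inftyValuation_apply,
    RatFunc.inftyValuation.polynomial _ hp0,
    ← WithZero.exp_add, ← WithZero.exp_zero, WithZero.exp_le_exp] at hinf
  omega

lemma inftyValuation_algebraMap_le {p q : Polynomial F} (h : q.degree ≤ p.degree) :
    RatFunc.inftyValuation F (algebraMap _ _ q) ≤ RatFunc.inftyValuation F (algebraMap _ _ p) := by
  rcases eq_or_ne q 0 with rfl | hq
  · simp
  have hp : p ≠ 0 := by rintro rfl; simp_all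
  rw [RatFunc.inftyValuation_apply, RatFunc.inftyValuation_apply,
    RatFunc.inftyValuation.polynomial _ hp, RatFunc.inftyValuation.polynomial _ hq,
    WithZero.exp_le_exp]
  exact_mod_cast Polynomial.natDegree_le_natDegree h

lemma inftyValuation_X_smul_ratFuncDeriv_le {k : Type*} [CommRing k] [Algebra k F] (g : RatFunc F) :
    RatFunc.inftyValuation F (((RatFunc.X : RatFunc F) • ratFuncDeriv k F) g) ≤
      RatFunc.inftyValuation F g := by
  refine valuation_derivation_le (A := Polynomial F) _ _ (fun p => ?_) g
  rw [Derivation.smul_apply, ratFuncDeriv_algebraMap, smul_eq_mul, ← RatFunc.algebraMap_X,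
    ← map_mul]
  refine inftyValuation_algebraMap_le ?_
  rcases eq_or_ne p 0 with rfl | hp
  · simp
  · rw [Polynomial.degree_mul, Polynomial.degree_X, add_comm]
    exact Nat.WithBot.add_one_le_of_lt (Polynomial.degree_derivative_lt hp)

lemma inftyValuation_ratFuncMapCoeff_le {k : Type*} [CommRing k] [Algebra k F]
    (d : Derivation k F F) (g : RatFunc F) :
    RatFunc.inftyValuation F (ratFuncMapCoeff d g) ≤ RatFunc.inftyValuation F g := by
  refine valuation_derivation_le (A := Polynomial F) _ _ (fun p => ?_) g
  rw [ratFuncMapCoeff, ratFuncExtension_algebraMap]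
  exact inftyValuation_algebraMap_le (degree_polynomialMapCoeff_le d p)

end Valuations

/-! ### Evaluation of forms at derivations -/

section Forms

variable {K A B C : Type u} [Field K] [CommRing A] [CommRing B] [CommRing C]
  [Algebra K A] [Algebra K B] [Algebra K C]

/-- The map `Ω_{A/K} → Ω_{B/K}` induced by a homomorphism `A → B` of `K`-algebras: the factorwise
description of `formMap`. -/
def kaehlerMap (g : A →ₐ[K] B) : Ω[A⁄K] →+ Ω[B⁄K] :=
  letI : Algebra A B := g.toRingHom.toAlgebra
  haveI : IsScalarTower K A B := IsScalarTower.of_algebraMap_eq fun r => (g.commutes r).symm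
  (KaehlerDifferential.map K K A B).toAddMonoidHom

lemma kaehlerMap_D (g : A →ₐ[K] B) (a : A) :
    kaehlerMap g (KaehlerDifferential.D K A a) = KaehlerDifferential.D K B (g a) :=
  let : Algebra A B := g.toRingHom.toAlgebra
  have : IsScalarTower K A B := IsScalarTower.of_algebraMap_eq fun r => (g.commutes r).symm
  KaehlerDifferential.map_D K K A B a

lemma kaehlerMap_smul (g : A →ₐ[K] B) (a : A) (x : Ω[A⁄K]) :
    kaehlerMap g (a • x) = g a • kaehlerMap g x := by
  let : Algebra A B := g.toRingHom.toAlgebra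
  have : IsScalarTower K A B := IsScalarTower.of_algebraMap_eq fun r => (g.commutes r).symm
  exact ((KaehlerDifferential.map K K A B).map_smul a x).trans (algebraMap_smul B a _).symm

lemma kaehler_induction {P : Ω[A⁄K] → Prop} (hD : ∀ a, P (KaehlerDifferential.D K A a))
    (hadd : ∀ x y, P x → P y → P (x + y)) (hsmul : ∀ (a : A) x, P x → P (a • x)) (x : Ω[A⁄K]) :
    P x := by
  have hx : x ∈ Submodule.span A (Set.range (KaehlerDifferential.D K A)) :=
    (KaehlerDifferential.span_range_derivation K A).symm ▸ Submodule.mem_top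
  induction hx using Submodule.span_induction with
  | mem x h => obtain ⟨a, rfl⟩ := h; exact hD a
  | zero => simpa using hD 0
  | add x y _ _ hx hy => exact hadd x y hx hy
  | smul a x _ hx => exact hsmul a x hx

lemma kaehlerMap_comp (h : B →ₐ[K] C) (g : A →ₐ[K] B) (x : Ω[A⁄K]) :
    kaehlerMap (h.comp g) x = kaehlerMap h (kaehlerMap g x) := by
  induction x using kaehler_induction with
  | hD a => simp only [kaehlerMap_D, AlgHom.comp_apply]
  | hadd x y hx hy => simp only [map_add, hx, hy]
  | hsmul a x hx => simp only [kaehlerMap_smul, hx, AlgHom.comp_apply]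

lemma formMap_ιMulti (g : A →ₐ[K] B) (p : ℕ) (v : Fin p → Ω[A⁄K]) :
    formMap g p (exteriorPower.ιMulti A p v) =
      exteriorPower.ιMulti B p fun i => kaehlerMap g (v i) := by
  let : Algebra A B := g.toRingHom.toAlgebra
  have : IsScalarTower K A B := IsScalarTower.of_algebraMap_eq fun r => (g.commutes r).symm
  exact exteriorPower.alternatingMapLinearEquiv_apply_ιMulti _ _

lemma formMap_smul (g : A →ₐ[K] B) (p : ℕ) (a : A) (x : ⋀[A]^p Ω[A⁄K]) :
    formMap g p (a • x) = g a • formMap g p x := by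
  let : Algebra A B := g.toRingHom.toAlgebra
  have : IsScalarTower K A B := IsScalarTower.of_algebraMap_eq fun r => (g.commutes r).symm
  refine Eq.trans ?_ (algebraMap_smul B a (formMap g p x)).symm
  exact (exteriorPower.alternatingMapLinearEquiv (R := A) (N := ⋀[B]^p Ω[B⁄K]) _).map_smul a x

lemma form_induction {p : ℕ} {P : (⋀[A]^p Ω[A⁄K]) → Prop} (h0 : P 0)
    (hι : ∀ v, P (exteriorPower.ιMulti A p v))
    (hadd : ∀ x y, P x → P y → P (x + y)) (hsmul : ∀ (a : A) x, P x → P (a • x))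
    (x : ⋀[A]^p Ω[A⁄K]) : P x := by
  have hx : x ∈ Submodule.span A (Set.range (exteriorPower.ιMulti A p (M := Ω[A⁄K]))) :=
    (exteriorPower.ιMulti_span A p Ω[A⁄K]).symm ▸ Submodule.mem_top
  induction hx using Submodule.span_induction with
  | mem x h => obtain ⟨a, rfl⟩ := h; exact hι a
  | zero => exact h0
  | add x y _ _ hx hy => exact hadd x y hx hy
  | smul a x _ hx => exact hsmul a x hx

lemma formMap_comp (h : B →ₐ[K] C) (g : A →ₐ[K] B) (p : ℕ) (x : ⋀[A]^p Ω[A⁄K]) :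
    formMap (h.comp g) p x = formMap h p (formMap g p x) := by
  induction x using form_induction with
  | h0 => simp only [map_zero]
  | hι v => simp only [formMap_ιMulti, kaehlerMap_comp]
  | hadd x y hx hy => simp only [map_add, hx, hy]
  | hsmul a x hx => simp only [formMap_smul, hx, AlgHom.comp_apply]

/-- The evaluation `da ∧ db ↦ D₁ a * D₂ b - D₂ a * D₁ b` of `2`-forms at a pair of derivations. -/
def evalForm (D₁ D₂ : Derivation K A A) : (⋀[A]^2 Ω[A⁄K]) →ₗ[A] A :=
  exteriorPower.alternatingMapLinearEquiv
    (Matrix.detRowAlternating.compLinearMap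
      (LinearMap.pi ![D₁.liftKaehlerDifferential, D₂.liftKaehlerDifferential]))

lemma evalForm_ιMulti (D₁ D₂ : Derivation K A A) (v : Fin 2 → Ω[A⁄K]) :
    evalForm D₁ D₂ (exteriorPower.ιMulti A 2 v) =
      D₁.liftKaehlerDifferential (v 0) * D₂.liftKaehlerDifferential (v 1) -
        D₂.liftKaehlerDifferential (v 0) * D₁.liftKaehlerDifferential (v 1) := by
  rw [evalForm, exteriorPower.alternatingMapLinearEquiv_apply_ιMulti]
  exact (Matrix.det_fin_two _).trans rfl

lemma evalForm_smul_left (c : A) (D₁ D₂ : Derivation K A A) :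
    evalForm (c • D₁) D₂ = c • evalForm D₁ D₂ := by
  have hc : (c • D₁).liftKaehlerDifferential = c • D₁.liftKaehlerDifferential :=
    map_smul (KaehlerDifferential.linearMapEquivDerivation K A).symm c D₁
  refine exteriorPower.linearMap_ext (AlternatingMap.ext fun v => ?_)
  simp only [LinearMap.compAlternatingMap_apply, LinearMap.smul_apply, evalForm_ιMulti, hc,
    smul_eq_mul]
  ring

lemma evalForm_formMap_mem_range (g : A →ₐ[K] B) (D₁ D₂ : Derivation K B B)
    (h₁ : ∀ a, D₁ (g a) ∈ g.range) (h₂ : ∀ a, D₂ (g a) ∈ g.range) (x : ⋀[A]^2 Ω[A⁄K]) :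
    evalForm D₁ D₂ (formMap g 2 x) ∈ g.range := by
  have hlift (D : Derivation K B B) (h : ∀ a, D (g a) ∈ g.range) (y : Ω[A⁄K]) :
      D.liftKaehlerDifferential (kaehlerMap g y) ∈ g.range := by
    induction y using kaehler_induction with
    | hD a => simpa only [kaehlerMap_D, Derivation.liftKaehlerDifferential_comp_D] using h a
    | hadd x y hx hy => rw [map_add, map_add]; exact add_mem hx hy
    | hsmul a x hx => rw [kaehlerMap_smul, map_smul]; exact mul_mem ⟨a, rfl⟩ hx
  induction x using form_induction with
  | h0 => simp only [map_zero, zero_mem]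
  | hι v =>
    rw [formMap_ιMulti, evalForm_ιMulti]
    exact sub_mem (mul_mem (hlift _ h₁ _) (hlift _ h₂ _)) (mul_mem (hlift _ h₂ _) (hlift _ h₁ _))
  | hadd x y hx hy => rw [map_add, map_add]; exact add_mem hx hy
  | hsmul a x hx => rw [formMap_smul, map_smul]; exact mul_mem ⟨a, rfl⟩ hx

lemma derivation_mul_eq_of_evalForm_eq_zero (g : A →ₐ[K] B) (D₁ D₂ : Derivation K B B)
    {ω : ⋀[A]^2 Ω[A⁄K]} (hω : Function.Surjective fun a : A => a • ω)
    (h : evalForm D₁ D₂ (formMap g 2 ω) = 0) (a b : A) :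
    D₁ (g a) * D₂ (g b) = D₂ (g a) * D₁ (g b) := by
  obtain ⟨c, hc⟩ := hω (exteriorPower.ιMulti A 2
    ![KaehlerDifferential.D K A a, KaehlerDifferential.D K A b])
  have hab := congrArg (fun ξ => evalForm D₁ D₂ (formMap g 2 ξ)) hc
  simp only [formMap_smul, map_smul, h, smul_zero, formMap_ιMulti, evalForm_ιMulti] at hab
  simpa [kaehlerMap_D, sub_eq_zero] using hab.symm

/-- A differential form on a field `L` over `K` is regular if it comes from a form on each valuation
ring of `L` that contains `K`, such a ring being encoded as a `K`-subalgebra that contains `x` or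
`x⁻¹` for each `x`. -/
def IsRegularForm {L : Type u} [Field L] [Algebra K L] {p : ℕ} (η : ⋀[L]^p Ω[L⁄K]) : Prop :=
  ∀ O : Subalgebra K L, (∀ x, x ∈ O ∨ x⁻¹ ∈ O) → η ∈ Set.range (formMap O.val p)

lemma IsRegularForm.valuation_evalForm_le_one {L : Type u} [Field L] [Algebra K L]
    {η : ⋀[L]^2 Ω[L⁄K]} (hη : IsRegularForm η) {Γ₀ : Type*} [LinearOrderedCommGroupWithZero Γ₀]
    (v : Valuation L Γ₀) (hv : ∀ c : K, v (algebraMap K L c) ≤ 1) (D₁ D₂ : Derivation K L L)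
    (h₁ : ∀ a, v a ≤ 1 → v (D₁ a) ≤ 1) (h₂ : ∀ a, v a ≤ 1 → v (D₂ a) ≤ 1) :
    v (evalForm D₁ D₂ η) ≤ 1 := by
  let O : Subalgebra K L := { v.integer with algebraMap_mem' := hv }
  obtain ⟨ξ, rfl⟩ := hη O v.valuationSubring.mem_or_inv_mem
  obtain ⟨a, ha⟩ := evalForm_formMap_mem_range O.val D₁ D₂ (fun a => ⟨⟨_, h₁ a a.2⟩, rfl⟩)
    (fun a => ⟨⟨_, h₂ a a.2⟩, rfl⟩) ξ
  exact ha ▸ a.2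

/-- At finite distance the evaluated form has no pole, so it is a polynomial in `t`. Since `t∂/∂t`
preserves the local ring at infinity, `t` times this polynomial has no pole there. -/
lemma IsRegularForm.evalForm_ratFunc_eq_zero {F : Type u} [Field F] [Algebra K F]
    {η : ⋀[RatFunc F]^2 Ω[RatFunc F⁄K]} (hη : IsRegularForm η) (d : Derivation K F F) :
    evalForm (ratFuncDeriv K F) (ratFuncMapCoeff d) η = 0 := by
  classical
  have hC (c : K) : algebraMap K (RatFunc F) c =
      algebraMap (Polynomial F) (RatFunc F) (Polynomial.C (algebraMap K F c)) :=
    (IsScalarTower.algebraMap_apply K (Polynomial F) (RatFunc F) c).trans rfl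
  refine ratFunc_eq_zero_of_valuation (fun v => ?_) ?_
  · refine hη.valuation_evalForm_le_one _ (fun c => hC c ▸ v.valuation_le_one _) _ _
      (fun a => valuation_derivation_le_one v _ fun p => ⟨_, (ratFuncDeriv_algebraMap p).symm⟩)
      (fun a => valuation_derivation_le_one v _
        fun p => ⟨_, (ratFuncExtension_algebraMap _ p).symm⟩)
  · have hv (c : K) : RatFunc.inftyValuation F (algebraMap K (RatFunc F) c) ≤ 1 := by
      rw [hC, ← map_one (RatFunc.inftyValuation F), ← map_one (algebraMap (Polynomial F) _)]
      exact inftyValuation_algebraMap_le (by simpa using Polynomial.degree_C_le)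
    have h := hη.valuation_evalForm_le_one _ hv (RatFunc.X • ratFuncDeriv K F) (ratFuncMapCoeff d)
      (fun a => (inftyValuation_X_smul_ratFuncDeriv_le a).trans)
      (fun a => (inftyValuation_ratFuncMapCoeff_le d a).trans)
    rwa [evalForm_smul_left] at h

end Forms

/-! ### Dimension -/

section Dimension

lemma topologicalKrullDim_eq_of_isClosedMap {X Y : Type*} [TopologicalSpace X] [TopologicalSpace Y]
    [QuasiSober X] [T0Space X] [QuasiSober Y] [T0Space Y] {p : X → Y} (hp : Continuous p)
    (hclosed : IsClosedMap p) (hsurj : Function.Surjective p)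
    (hfib : ∀ x y, x ⤳ y → p x = p y → x = y) :
    topologicalKrullDim X = topologicalKrullDim Y := by
  let := specializationOrder X
  let := specializationOrder Y
  have hmono : StrictMono p := fun x y hxy =>
    lt_of_le_of_ne (hxy.le.map hp) fun e => hxy.ne' (hfib y x hxy.le e.symm)
  have hlift (x : X) (w : Y) (hw : w < p x) : ∃ x' < x, p x' = w := by
    obtain ⟨x', hx', rfl⟩ := hclosed.specializingMap hw.le
    exact ⟨x', lt_of_le_of_ne hx' (by rintro rfl; exact hw.ne rfl), rfl⟩
  calc
    topologicalKrullDim X = Order.krullDim X :=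
      Order.krullDim_eq_of_orderIso irreducibleSetEquivPoints
    _ = Order.krullDim Y := by
      rw [Order.krullDim_eq_iSup_height, Order.krullDim_eq_iSup_height, ← hsurj.iSup_comp]
      exact iSup_congr fun x => congrArg _ (Order.height_eq_of_strictMono p hmono hlift x)
    _ = topologicalKrullDim Y := (Order.krullDim_eq_of_orderIso irreducibleSetEquivPoints).symm

lemma topologicalKrullDim_eq_of_isFinite {X Y : Scheme.{u}} (p : X ⟶ Y) [IsFinite p]
    [Surjective p] : topologicalKrullDim X = topologicalKrullDim Y := by
  refine topologicalKrullDim_eq_of_isClosedMap p.continuous p.isClosedMap p.surjective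
    fun x y hxy e => ?_
  have := (p.isDiscrete_preimage_singleton (p y)).to_subtype
  have hxy' : (⟨x, e⟩ : p ⁻¹' {p y}) ⤳ ⟨y, rfl⟩ :=
    Topology.IsInducing.subtypeVal.specializes_iff.mp hxy
  exact congrArg Subtype.val hxy'.eq

lemma IsCurve.baseChange_of_finite {K L : Type u} [Field K] [Field L] {C : Scheme.{u}}
    {c : C ⟶ Spec (.of K)} (hc : IsCurve c) [GeometricallyIntegral c] {φ : K →+* L}
    (hφ : φ.Finite) : IsCurve (pullback.snd c (Spec.map (CommRingCat.ofHom φ))) := by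
  have := hc.separated
  have := hc.locallyOfFiniteType
  have := hc.quasiCompact
  have : IsFinite (Spec.map (CommRingCat.ofHom φ)) := (IsFinite.SpecMap_iff _).mpr hφ
  have : IsIntegral (pullback c (Spec.map (CommRingCat.ofHom φ))) :=
    GeometricallyIntegral.isIntegral_of_subsingleton
      (pullback.snd c (Spec.map (CommRingCat.ofHom φ)))
  exact
    { reduced := inferInstance
      separated := inferInstance
      locallyOfFiniteType := inferInstance
      quasiCompact := inferInstance
      dim_eq_one := (topologicalKrullDim_eq_of_isFinite
        (pullback.fst c (Spec.map (CommRingCat.ofHom φ)))).trans hc.dim_eq_one }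

lemma isIntegral_of_surjective {X Y : Scheme.{u}} [IsIntegral X] [IsReduced Y] (p : X ⟶ Y)
    [Surjective p] : IsIntegral Y := by
  have : IrreducibleSpace Y := p.surjective.irreducibleSpace p.continuous
  exact isIntegral_of_irreducibleSpace_of_isReduced Y

end Dimension

/-! ### Points with values in rings -/

section Points

variable {k : Type u} [Field k] {X : Scheme.{u}} (f : X ⟶ Spec (.of k))

lemma appTop_eq_appLE {X Y : Scheme.{u}} (g : X ⟶ Y) :
    g.appTop = g.appLE ⊤ ⊤ (show ⊤ ≤ g ⁻¹ᵁ ⊤ from le_rfl) :=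
  g.appLE_eq_app.symm

/-- The value of functions on `U` at a point `x : Spec R ⟶ X` that factors through `U`. -/
def valueAt {R : Type u} [CommRing R] [Algebra k R] (x : Spec (.of R) ⟶ X)
    (hx : x ≫ f = Spec.map (CommRingCat.ofHom (algebraMap k R))) (U : X.Opens)
    (hU : ⊤ ≤ x ⁻¹ᵁ U) : Sec f U →ₐ[k] R where
  __ := (x.appLE U ⊤ hU ≫ (Scheme.ΓSpecIso (.of R)).hom).hom
  commutes' r := by
    have hr : (Scheme.ΓSpecIso (.of k)).inv ≫ f.appTop ≫
        X.presheaf.map (homOfLE le_top : U ⟶ ⊤).op ≫ x.appLE U ⊤ hU ≫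
          (Scheme.ΓSpecIso (.of R)).hom = CommRingCat.ofHom (algebraMap k R) := by
      rw [Scheme.Hom.map_appLE_assoc, appTop_eq_appLE f,
        Scheme.Hom.appLE_comp_appLE_assoc, ← appTop_eq_appLE, hx,
        Scheme.ΓSpecIso_naturality, Iso.inv_hom_id_assoc]
    exact ConcreteCategory.congr_hom hr r

variable {f} {R : Type u} [CommRing R] [Algebra k R] (x : Spec (.of R) ⟶ X)
  (hx : x ≫ f = Spec.map (CommRingCat.ofHom (algebraMap k R)))

lemma valueAt_comp_res {U V : X.Opens} (h : V ≤ U) (hV : ⊤ ≤ x ⁻¹ᵁ V) :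
    (valueAt f x hx V hV).comp (res f h) = valueAt f x hx U (hV.trans (x.preimage_mono h)) := by
  ext a
  have ha : X.presheaf.map (homOfLE h).op ≫ x.appLE V ⊤ hV ≫ (Scheme.ΓSpecIso (.of R)).hom =
      x.appLE U ⊤ (hV.trans (x.preimage_mono h)) ≫ (Scheme.ΓSpecIso (.of R)).hom := by
    rw [Scheme.Hom.map_appLE_assoc]
  exact ConcreteCategory.congr_hom ha a

lemma valueAt_SpecMap_comp {S : Type u} [CommRing S] [Algebra k S] (y : Spec (.of S) ⟶ X)
    (hy : y ≫ f = Spec.map (CommRingCat.ofHom (algebraMap k S))) (g : R →ₐ[k] S)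
    (hg : Spec.map (CommRingCat.ofHom g.toRingHom) ≫ x = y) {U : X.Opens} (hU : ⊤ ≤ x ⁻¹ᵁ U)
    (hU' : ⊤ ≤ y ⁻¹ᵁ U) : valueAt f y hy U hU' = g.comp (valueAt f x hx U hU) := by
  ext a
  subst hg
  have ha : (Spec.map (CommRingCat.ofHom g.toRingHom) ≫ x).appLE U ⊤ hU' ≫
      (Scheme.ΓSpecIso (.of S)).hom =
        (x.appLE U ⊤ hU ≫ (Scheme.ΓSpecIso (.of R)).hom) ≫ CommRingCat.ofHom g.toRingHom := by
    rw [Category.assoc, ← Scheme.ΓSpecIso_naturality,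
      appTop_eq_appLE (Spec.map (CommRingCat.ofHom g.toRingHom)),
      Scheme.Hom.appLE_comp_appLE_assoc]
  exact ConcreteCategory.congr_hom ha a

lemma SpecMap_valueAt_fromSpec (U : X.affineOpens) (hU : ⊤ ≤ x ⁻¹ᵁ U.1) :
    Spec.map (CommRingCat.ofHom (R := Γ(X, U.1)) (valueAt f x hx U.1 hU).toRingHom) ≫
      U.2.fromSpec = x := by
  have h := IsAffineOpen.SpecMap_appLE_fromSpec x U.2 (isAffineOpen_top _) hU
  rw [IsAffineOpen.fromSpec_top, Iso.eq_inv_comp, Scheme.isoSpec_Spec_hom,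
    ← Spec.map_comp_assoc] at h
  exact h

lemma exists_affineOpen_le_preimage {R : Type u} [CommRing R] [IsLocalRing R]
    (x : Spec (.of R) ⟶ X) {W : X.Opens} (hW : ⊤ ≤ x ⁻¹ᵁ W) :
    ∃ U : X.affineOpens, U.1 ≤ W ∧ ⊤ ≤ x ⁻¹ᵁ U.1 := by
  obtain ⟨_, ⟨U, hU, rfl⟩, hxU, hUW⟩ := X.isBasis_affineOpens.exists_subset_of_mem_open
    (show x (IsLocalRing.closedPoint R) ∈ (W : Set X) from hW trivial) W.isOpen
  exact ⟨⟨U, hU⟩, hUW, (Scheme.preimage_eq_top_of_closedPoint_mem x hxU).ge⟩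

lemma isClosed_singleton_of_isAlgebraic {F : Type u} [Field F] [Algebra k F]
    [Algebra.IsAlgebraic k F] (x : Spec (.of F) ⟶ X)
    (hx : x ≫ f = Spec.map (CommRingCat.ofHom (algebraMap k F))) (s : Spec (.of F)) :
    IsClosed {x s} := by
  refine isClosed_of_closure_subset fun y hy => ?_
  have hxy : x s ⤳ y := specializes_iff_mem_closure.mpr hy
  obtain ⟨_, ⟨U, hU, rfl⟩, hyU, -⟩ := X.isBasis_affineOpens.exists_subset_of_mem_open
    (Set.mem_univ y) isOpen_univ
  have hxU : ⊤ ≤ x ⁻¹ᵁ U := fun t _ =>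
    (Subsingleton.elim s t) ▸ (hxy.mem_open U.isOpen hyU : x s ∈ U)
  let v : Sec f U →ₐ[k] F := valueAt f x hx U hxU
  obtain ⟨p, hp⟩ : ∃ p, Spec.map (CommRingCat.ofHom (R := Γ(X, U)) v.toRingHom) s = p := ⟨_, rfl⟩
  have hxp : x s = hU.fromSpec p := by
    rw [← hp, ← Scheme.Hom.comp_apply, SpecMap_valueAt_fromSpec x hx ⟨U, hU⟩ hxU]
  have hmax : p.asIdeal.IsMaximal := by
    have hs : s.asIdeal.IsMaximal := s.2.isMaximal'
    have hv : v.toRingHom.IsIntegral :=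
      RingHom.IsIntegral.tower_top (algebraMap k (Sec f U)) v.toRingHom <| by
        rw [AlgHom.toRingHom_eq_coe, v.comp_algebraMap]
        exact Algebra.IsIntegral.isIntegral
    exact hp ▸ Ideal.isMaximal_comap_of_isIntegral_of_isMaximal' v.toRingHom hv s.asIdeal
  obtain ⟨q, rfl⟩ : y ∈ Set.range hU.fromSpec := by rwa [hU.range_fromSpec]
  have hpq : p ⤳ q := by
    have : IsOpenImmersion hU.fromSpec := hU.isOpenImmersion_fromSpec
    rwa [hxp, hU.fromSpec.isOpenEmbedding.isInducing.specializes_iff] at hxy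
  have hle : p.asIdeal ≤ q.asIdeal := (PrimeSpectrum.le_iff_specializes p q).mpr hpq
  rw [hxp, PrimeSpectrum.ext (hmax.eq_of_le q.2.ne_top hle), Set.mem_singleton_iff]

lemma topologicalKrullDim_le_zero_of_isClosed_genericPoint {T : Type*} [TopologicalSpace T]
    [T0Space T] [QuasiSober T] [IrreducibleSpace T] (h : IsClosed {genericPoint T}) :
    topologicalKrullDim T ≤ 0 := by
  have huniv : ({genericPoint T} : Set T) = Set.univ := by
    rw [← h.closure_eq, (genericPoint_spec T).def]
  have : Subsingleton T := Set.subsingleton_univ_iff.mp (huniv ▸ Set.subsingleton_singleton)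
  exact topologicalKrullDim_zero_of_discreteTopology T

lemma transcendental_of_eq_genericPoint [IrreducibleSpace X] (hdim : 0 < topologicalKrullDim X)
    {F : Type u} [Field F] [Algebra k F] (x : Spec (.of F) ⟶ X)
    (hx : x ≫ f = Spec.map (CommRingCat.ofHom (algebraMap k F))) {s : Spec (.of F)}
    (hs : x s = genericPoint X) : Algebra.Transcendental k F := by
  rw [Algebra.transcendental_iff_not_isAlgebraic]
  intro halg
  exact hdim.not_ge (topologicalKrullDim_le_zero_of_isClosed_genericPoint
    (hs ▸ isClosed_singleton_of_isAlgebraic x hx s))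

end Points

/-! ### Regular forms on proper schemes -/

section RegularForms

variable {k : Type u} [Field k] {X : Scheme.{u}} {f : X ⟶ Spec (.of k)} {p : ℕ}
  {ω : ∀ U : X.affineOpens, ⋀[Sec f U.1]^p Ω[Sec f U.1⁄k]}
  (hω : ∀ (U V : X.affineOpens) (h : V.1 ≤ U.1), formMap (res f h) p (ω U) = ω V)

include hω in
lemma formMap_valueAt_eq {R : Type u} [CommRing R] [IsLocalRing R] [Algebra k R]
    (x : Spec (.of R) ⟶ X) (hx : x ≫ f = Spec.map (CommRingCat.ofHom (algebraMap k R)))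
    (U V : X.affineOpens) (hU : ⊤ ≤ x ⁻¹ᵁ U.1) (hV : ⊤ ≤ x ⁻¹ᵁ V.1) :
    formMap (valueAt f x hx U.1 hU) p (ω U) = formMap (valueAt f x hx V.1 hV) p (ω V) := by
  obtain ⟨W, hW, hxW⟩ := exists_affineOpen_le_preimage x (W := U.1 ⊓ V.1)
    fun y _ => ⟨hU trivial, hV trivial⟩
  have restrict (U : X.affineOpens) (hU : ⊤ ≤ x ⁻¹ᵁ U.1) (h : W.1 ≤ U.1) :
      formMap (valueAt f x hx U.1 hU) p (ω U) = formMap (valueAt f x hx W.1 hxW) p (ω W) := by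
    rw [← valueAt_comp_res x hx h hxW, formMap_comp, hω]
  rw [restrict U hU (hW.trans inf_le_left), restrict V hV (hW.trans inf_le_right)]

lemma exists_lift_of_isProper [IsProper f] {L : Type u} [Field L] [Algebra k L]
    (x : Spec (.of L) ⟶ X) (hx : x ≫ f = Spec.map (CommRingCat.ofHom (algebraMap k L)))
    (O : Subalgebra k L) [ValuationRing O] [IsFractionRing O L] :
    ∃ l : Spec (.of O) ⟶ X, Spec.map (CommRingCat.ofHom O.val.toRingHom) ≫ l = x ∧
      l ≫ f = Spec.map (CommRingCat.ofHom (algebraMap k O)) := by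
  let S : ValuativeCommSq f :=
    { R := O
      K := L
      i₁ := x
      i₂ := Spec.map (CommRingCat.ofHom (algebraMap k O))
      commSq := ⟨by rw [hx, ← Spec.map_comp]; rfl⟩ }
  have hval := (IsProper.eq_valuativeCriterion.le _ _ _ ‹IsProper f›).1.1.1
  obtain ⟨⟨l, hl, hl'⟩⟩ := hval.existence S
  exact ⟨l, hl, hl'⟩

include hω in
lemma isRegularForm_formMap_valueAt [IsProper f] {L : Type u} [Field L] [Algebra k L]
    (x : Spec (.of L) ⟶ X) (hx : x ≫ f = Spec.map (CommRingCat.ofHom (algebraMap k L)))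
    (U : X.affineOpens) (hU : ⊤ ≤ x ⁻¹ᵁ U.1) :
    IsRegularForm (formMap (valueAt f x hx U.1 hU) p (ω U)) := by
  intro O hO
  let V : ValuationSubring L := { O.toSubring with mem_or_inv_mem' := hO }
  have : ValuationRing O := inferInstanceAs (ValuationRing V)
  have : IsFractionRing O L := inferInstanceAs (IsFractionRing V L)
  obtain ⟨l, hlx, hl⟩ := exists_lift_of_isProper x hx O
  obtain ⟨V, -, hlV⟩ := exists_affineOpen_le_preimage l (W := ⊤) le_rfl
  have hxV : ⊤ ≤ x ⁻¹ᵁ V.1 := hlx ▸ fun _ _ => hlV trivial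
  refine ⟨formMap (valueAt f l hl V.1 hlV) p (ω V), ?_⟩
  rw [formMap_valueAt_eq hω x hx U V hU hxV, valueAt_SpecMap_comp l hl x hx O.val hlx hlV hxV,
    formMap_comp]

end RegularForms

/-! ### Fields of definition of points -/

section FieldOfDefinition

variable {k L : Type u} [Field k] [Field L] [Algebra k L] {E : IntermediateField k L}

/-- The `L`-valued point `x` of `X` is defined over the subfield `E` of `L`: it factors through
`Spec L ⟶ Spec E`. -/
def IsDefinedOver (E : IntermediateField k L) {X : Scheme.{u}} (x : Spec (.of L) ⟶ X) : Prop :=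
  ∃ x₀ : Spec (.of E) ⟶ X, Spec.map (CommRingCat.ofHom (algebraMap E L)) ≫ x₀ = x

lemma isDefinedOver_SpecMap_iff {A : Type u} [CommRing A] {ρ : A →+* L} :
    IsDefinedOver E (Spec.map (CommRingCat.ofHom ρ)) ↔ ∀ a, ρ a ∈ E := by
  constructor
  · rintro ⟨x₀, hx₀⟩ a
    obtain ⟨ρ₀, rfl⟩ := Spec.map_surjective x₀
    rw [← Spec.map_comp, Spec.map_inj] at hx₀
    exact (ConcreteCategory.congr_hom hx₀ a : _ = ρ a) ▸ (ρ₀.hom a).2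
  · intro h
    exact ⟨Spec.map (CommRingCat.ofHom (ρ.codRestrict E.toSubfield h)), (Spec.map_comp _ _).symm⟩

namespace IsDefinedOver

lemma comp {X Y : Scheme.{u}} {x : Spec (.of L) ⟶ X} (h : IsDefinedOver E x) (g : X ⟶ Y) :
    IsDefinedOver E (x ≫ g) := by
  obtain ⟨x₀, rfl⟩ := h
  exact ⟨x₀ ≫ g, (Category.assoc _ _ _).symm⟩

lemma of_comp_isOpenImmersion {X Y : Scheme.{u}} {x : Spec (.of L) ⟶ X} (ι : X ⟶ Y)
    [IsOpenImmersion ι] (h : IsDefinedOver E (x ≫ ι)) : IsDefinedOver E x := by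
  obtain ⟨y, hy⟩ := h
  have hrange : Set.range y ⊆ Set.range ι := by
    rintro _ ⟨s, rfl⟩
    obtain ⟨t, rfl⟩ := (Spec.map (CommRingCat.ofHom (algebraMap E L))).surjective s
    rw [← Scheme.Hom.comp_apply, hy]
    exact ⟨x t, rfl⟩
  refine ⟨IsOpenImmersion.lift ι y hrange, ?_⟩
  rw [← cancel_mono ι, Category.assoc, IsOpenImmersion.lift_fac, hy]

lemma of_fst_of_snd {X Y Z : Scheme.{u}} {g : X ⟶ Z} {h : Y ⟶ Z}
    {q : Spec (.of L) ⟶ pullback g h} (hfst : IsDefinedOver E (q ≫ pullback.fst g h))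
    (hsnd : IsDefinedOver E (q ≫ pullback.snd g h)) : IsDefinedOver E q := by
  obtain ⟨x₀, hx₀⟩ := hfst
  obtain ⟨y₀, hy₀⟩ := hsnd
  have : Epi (Spec.map (CommRingCat.ofHom (algebraMap E L))) := Flat.epi_of_flat_of_surjective _
  have hcond : x₀ ≫ g = y₀ ≫ h := by
    rw [← cancel_epi (Spec.map (CommRingCat.ofHom (algebraMap E L))), reassoc_of% hx₀,
      reassoc_of% hy₀, pullback.condition]
  refine ⟨pullback.lift x₀ y₀ hcond, pullback.hom_ext ?_ ?_⟩
  · rw [Category.assoc, pullback.lift_fst, hx₀]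
  · rw [Category.assoc, pullback.lift_snd, hy₀]

lemma mem_of_fromSpecResidueField {X : Scheme.{u}} {η : X} {i : X.residueField η ⟶ .of L}
    (h : IsDefinedOver E (Spec.map i ≫ X.fromSpecResidueField η)) (a : X.residueField η) :
    i.hom a ∈ E := by
  obtain ⟨x₀, hx₀⟩ := h
  obtain ⟨⟨ξ, g⟩, rfl⟩ := (Scheme.SpecToEquivOfField E X).symm.surjective x₀
  rw [Scheme.SpecToEquivOfField_symm_apply] at hx₀
  obtain rfl : ξ = η := by
    have := congrArg (fun m : Spec (.of L) ⟶ X => m (IsLocalRing.closedPoint L)) hx₀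
    change X.fromSpecResidueField ξ _ = X.fromSpecResidueField η _ at this
    rwa [Scheme.fromSpecResidueField_apply, Scheme.fromSpecResidueField_apply] at this
  rw [← Category.assoc, cancel_mono, ← Spec.map_comp, Spec.map_inj] at hx₀
  exact (ConcreteCategory.congr_hom hx₀ a : _ = i.hom a) ▸ (g.hom a).2

end IsDefinedOver

lemma isDefinedOver_constants {X : Scheme.{u}} {f : X ⟶ Spec (.of k)} (x : Spec (.of L) ⟶ X)
    (hx : x ≫ f = Spec.map (CommRingCat.ofHom (algebraMap k L))) (U : X.affineOpens)
    (hU : ⊤ ≤ x ⁻¹ᵁ U.1) (D : Derivation k L L) (hD : ∀ a, D (valueAt f x hx U.1 hU a) = 0) :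
    IsDefinedOver (constants D) x := by
  rw [← SpecMap_valueAt_fromSpec x hx U hU]
  exact (isDefinedOver_SpecMap_iff.mpr fun a => mem_constants.mpr (hD a)).comp _

end FieldOfDefinition

lemma derivation_eq_zero_of_trivialCanonicalBundle {k : Type u} [Field k] {X : Scheme.{u}}
    {f : X ⟶ Spec (.of k)} [IsProper f] (hf : TrivialCanonicalBundle f) {F : Type u} [Field F]
    [Algebra k F] (x : Spec (.of (RatFunc F)) ⟶ X)
    (hx : x ≫ f = Spec.map (CommRingCat.ofHom (algebraMap k (RatFunc F))))
    (H : ∀ D : Derivation k (RatFunc F) (RatFunc F), IsDefinedOver (constants D) x → D = 0)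
    (d : Derivation k F F) : d = 0 := by
  obtain ⟨ω, hω, hbij⟩ := hf
  obtain ⟨U, -, hU⟩ := exists_affineOpen_le_preimage x (W := ⊤) le_rfl
  have hdep := derivation_mul_eq_of_evalForm_eq_zero (valueAt f x hx U.1 hU) _ _ (hbij U).2
    ((isRegularForm_formMap_valueAt hω x hx U hU).evalForm_ratFunc_eq_zero d)
  have hderiv : ratFuncDeriv k F ≠ 0 := fun h => by
    simpa [h] using ratFuncDeriv_X (k := k) (F := F)
  obtain ⟨c, hc⟩ := exists_eq_smul_of_forall_mul_eq
    (fun D hD => H D (isDefinedOver_constants x hx U hU D hD)) hderiv hdep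
  have hc₀ : c = 0 := by
    have hX := DFunLike.congr_fun hc RatFunc.X
    rwa [ratFuncMapCoeff_X, Derivation.smul_apply, ratFuncDeriv_X, smul_eq_mul, mul_one,
      eq_comm] at hX
  ext a
  apply RatFunc.C_injective
  rw [← ratFuncMapCoeff_C, hc, hc₀, zero_smul, Derivation.zero_apply, Derivation.zero_apply,
    map_zero]

/-! ### Points of the generic fibre -/

section GenericFibre

variable {k : Type u} [Field k]

variable (k) in
lemma exists_chartToRatFunc_eq_X : ∃ e, P1.chartToRatFunc k e = RatFunc.X := by
  refine ⟨HomogeneousLocalization.Away.mk (MvPolynomial.homogeneousSubmodule (Fin 2) k)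
    ((MvPolynomial.mem_homogeneousSubmodule 1 _).mpr (MvPolynomial.isHomogeneous_X k 0)) 1
    (MvPolynomial.X 1) ?_, ?_⟩
  · simpa using MvPolynomial.isHomogeneous_X k (1 : Fin 2)
  · rw [P1.chartToRatFunc, RingHom.comp_apply, HomogeneousLocalization.algebraMap_apply,
      HomogeneousLocalization.Away.val_mk, Localization.mk_eq_mk', IsLocalization.Away.lift,
      IsLocalization.lift_mk'_spec]
    simp

lemma chartToRatFunc_fromZeroRingHom (a : MvPolynomial.homogeneousSubmodule (Fin 2) k 0) :
    P1.chartToRatFunc k (HomogeneousLocalization.fromZeroRingHom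
      (MvPolynomial.homogeneousSubmodule (Fin 2) k) (Submonoid.powers (MvPolynomial.X 0)) a) =
      MvPolynomial.aeval ![(1 : RatFunc k), RatFunc.X] a.1 := by
  rw [P1.chartToRatFunc, RingHom.comp_apply, HomogeneousLocalization.algebraMap_apply]
  exact (congrArg _ (Localization.mk_one_eq_algebraMap a.1)).trans
    (IsLocalization.Away.lift_eq _ _ _)

lemma genericPoint_toSpec :
    P1.genericPoint k ≫ P1.toSpec k =
      Spec.map (CommRingCat.ofHom (algebraMap k (RatFunc k))) := by
  rw [P1.genericPoint, P1.toSpec, Category.assoc, Proj.awayι_toSpecZero_assoc, ← Spec.map_comp,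
    ← Spec.map_comp]
  congr 1
  ext r
  exact (chartToRatFunc_fromZeroRingHom _).trans (MvPolynomial.aeval_C _ r)

lemma IsDefinedOver.mem_of_comp_genericPoint {L : Type u} [Field L] [Algebra k L]
    {E : IntermediateField k L} {ρ : RatFunc k →+* L}
    (h : IsDefinedOver E (Spec.map (CommRingCat.ofHom ρ) ≫ P1.genericPoint k)) :
    ρ RatFunc.X ∈ E := by
  obtain ⟨e, he⟩ := exists_chartToRatFunc_eq_X k
  rw [P1.genericPoint, ← Category.assoc, ← Spec.map_comp, ← CommRingCat.ofHom_comp] at h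
  rw [← he]
  exact isDefinedOver_SpecMap_iff.mp (h.of_comp_isOpenImmersion _) e

section BaseChange

variable {X : Scheme.{u}} {π : X ⟶ P1 k} {φ : RatFunc k →ₐ[k] RatFunc k} {L : Type u} [Field L]
  [Algebra k L] {ψ : RatFunc k →ₐ[k] L}
  {q : Spec (.of L) ⟶ pullback (genericFibreToSpec π) (Spec.map (CommRingCat.ofHom φ.toRingHom))}
  (hq : q ≫ genericFibreBaseChangeToSpec π φ = Spec.map (CommRingCat.ofHom ψ.toRingHom))

include hq

lemma comp_fst_comp_genericFibreToSpec :
    q ≫ pullback.fst _ _ ≫ genericFibreToSpec π =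
      Spec.map (CommRingCat.ofHom (ψ.comp φ).toRingHom) := by
  rw [pullback.condition, reassoc_of% hq, ← Spec.map_comp]
  rfl

lemma comp_fst_fst_comp :
    q ≫ pullback.fst _ _ ≫ pullback.fst _ _ ≫ π =
      Spec.map (CommRingCat.ofHom (ψ.comp φ).toRingHom) ≫ P1.genericPoint k := by
  rw [pullback.condition, ← comp_fst_comp_genericFibreToSpec hq]
  simp only [Category.assoc]

lemma comp_fst_fst_comp_eq_SpecMap_algebraMap {f : X ⟶ Spec (.of k)}
    (hπ : π ≫ P1.toSpec k = f) :
    (q ≫ pullback.fst _ _ ≫ pullback.fst _ _) ≫ f =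
      Spec.map (CommRingCat.ofHom (algebraMap k L)) := by
  have h := comp_fst_fst_comp hq =≫ P1.toSpec k
  simp only [Category.assoc, hπ, genericPoint_toSpec, ← Spec.map_comp] at h ⊢
  rw [h]
  congr 1
  ext r
  exact (ψ.comp φ).commutes r

lemma isDefinedOver_of_fst_fst {E : IntermediateField k L} [IsIntegrallyClosedIn E L]
    (h : IsDefinedOver E (q ≫ pullback.fst _ _ ≫ pullback.fst _ _)) : IsDefinedOver E q := by
  have hX : ψ.comp φ RatFunc.X ∈ E := by
    have hcomp := h.comp π
    simp only [Category.assoc] at hcomp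
    rw [comp_fst_fst_comp hq] at hcomp
    exact hcomp.mem_of_comp_genericPoint
  have hψ : ψ.fieldRange ≤ E := by
    refine ratFunc_fieldRange_le_of_mem E ψ ?_ hX
    exact fun h => RatFunc.transcendental_X ((isAlgebraic_algHom_iff φ φ.injective).mp h)
  refine .of_fst_of_snd (.of_fst_of_snd ?_ ?_) ?_
  · simpa only [Category.assoc] using h
  · rw [Category.assoc, comp_fst_comp_genericFibreToSpec hq, isDefinedOver_SpecMap_iff]
    exact fun a => hψ ⟨φ a, rfl⟩
  · rw [hq, isDefinedOver_SpecMap_iff]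
    exact fun a => hψ ⟨a, rfl⟩

end BaseChange

end GenericFibre

/-! ### Constant curves -/

section Constant

variable {k : Type u} [Field k]

lemma eq_top_of_isDefinedOver_of_fromSpecResidueField {C : Scheme.{u}} {c : C ⟶ Spec (.of k)}
    {η : C} [Algebra k (C.residueField η)] {ψ : RatFunc k →ₐ[k] RatFunc (C.residueField η)}
    (hψ : ψ RatFunc.X = RatFunc.X) {z : Spec (.of (RatFunc (C.residueField η))) ⟶
      pullback c (Spec.map (CommRingCat.ofHom (algebraMap k (RatFunc k))))}
    (hfst : z ≫ pullback.fst _ _ = Spec.map (CommRingCat.ofHom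
      (algebraMap (C.residueField η) (RatFunc (C.residueField η)))) ≫ C.fromSpecResidueField η)
    (hsnd : z ≫ pullback.snd _ _ = Spec.map (CommRingCat.ofHom ψ.toRingHom))
    {E : IntermediateField k (RatFunc (C.residueField η))} (h : IsDefinedOver E z) : E = ⊤ := by
  refine ratFunc_eq_top_of_mem E (hfst ▸ h.comp (pullback.fst _ _)).mem_of_fromSpecResidueField ?_
  exact hψ ▸ isDefinedOver_SpecMap_iff.mp (hsnd ▸ h.comp (pullback.snd _ _)) RatFunc.X

lemma exists_point_pullback_of_isIntegral {C : Scheme.{u}} [IsIntegral C] (c : C ⟶ Spec (.of k))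
    (hdim : 0 < topologicalKrullDim C) :
    ∃ (F : Type u) (_ : Field F) (_ : Algebra k F) (_ : Algebra.Transcendental k F)
      (ψ : RatFunc k →ₐ[k] RatFunc F) (z : Spec (.of (RatFunc F)) ⟶
        pullback c (Spec.map (CommRingCat.ofHom (algebraMap k (RatFunc k))))),
      z ≫ pullback.snd _ _ = Spec.map (CommRingCat.ofHom ψ.toRingHom) ∧
        ∀ E : IntermediateField k (RatFunc F), IsDefinedOver E z → E = ⊤ := by
  let η := genericPoint C
  obtain ⟨α, hα⟩ := Spec.map_surjective (C.fromSpecResidueField η ≫ c)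
  let : Algebra k (C.residueField η) := α.hom.toAlgebra
  have htr : Algebra.Transcendental k (C.residueField η) :=
    transcendental_of_eq_genericPoint hdim (C.fromSpecResidueField η) hα.symm
      (C.fromSpecResidueField_apply η (IsLocalRing.closedPoint _))
  obtain ⟨ψ, hψ⟩ := exists_ratFunc_algHom_X_eq_X k (C.residueField η)
  have hcond : (Spec.map (CommRingCat.ofHom
      (algebraMap (C.residueField η) (RatFunc (C.residueField η)))) ≫
        C.fromSpecResidueField η) ≫ c = Spec.map (CommRingCat.ofHom ψ.toRingHom) ≫
        Spec.map (CommRingCat.ofHom (algebraMap k (RatFunc k))) := by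
    rw [Category.assoc, ← hα, ← Spec.map_comp, ← Spec.map_comp]
    congr 1
    ext r
    exact (IsScalarTower.algebraMap_apply k (C.residueField η) _ r).symm.trans (ψ.commutes r).symm
  exact ⟨C.residueField η, inferInstance, inferInstance, htr, ψ, pullback.lift _ _ hcond,
    pullback.lift_snd _ _ _, fun E => eq_top_of_isDefinedOver_of_fromSpecResidueField hψ
      (pullback.lift_fst _ _ _) (pullback.lift_snd _ _ _)⟩

lemma IsConstant.exists_point {Y : Scheme.{u}} [IsIntegral Y] {y : Y ⟶ Spec (.of (RatFunc k))}
    (h : IsConstant k y) :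
    ∃ (F : Type u) (_ : Field F) (_ : Algebra k F) (_ : Algebra.Transcendental k F)
      (ψ : RatFunc k →ₐ[k] RatFunc F) (q : Spec (.of (RatFunc F)) ⟶ Y),
      q ≫ y = Spec.map (CommRingCat.ofHom ψ.toRingHom) ∧
        ∀ E : IntermediateField k (RatFunc F), IsDefinedOver E q → E = ⊤ := by
  obtain ⟨C, c, hc, ⟨e⟩⟩ := h
  let g : Y ≅ pullback c (Spec.map (CommRingCat.ofHom (algebraMap k (RatFunc k)))) :=
    (Over.forget _).mapIso e
  have hg : g.inv ≫ y = pullback.snd _ _ := Over.w e.inv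
  have := hc.reduced
  have : IsIntegral C := isIntegral_of_surjective (g.hom ≫ pullback.fst _ _)
  obtain ⟨F, _, _, htr, ψ, z, hz, hE⟩ :=
    exists_point_pullback_of_isIntegral c (hc.dim_eq_one ▸ zero_lt_one)
  refine ⟨F, _, _, htr, ψ, z ≫ g.inv, by rw [Category.assoc, hg, hz], fun E hq => hE E ?_⟩
  simpa only [Category.assoc, g.inv_hom_id, Category.comp_id] using hq.comp g.hom

end Constant

lemma not_isConstant {k : Type u} [Field k] [CharZero k] {X : Scheme.{u}} {f : X ⟶ Spec (.of k)}
    [IsProper f] (hf : TrivialCanonicalBundle f) {π : X ⟶ P1 k} (hπ : π ≫ P1.toSpec k = f)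
    [GeometricallyIntegral (genericFibreToSpec π)] (φ : RatFunc k →ₐ[k] RatFunc k) :
    ¬ IsConstant k (genericFibreBaseChangeToSpec π φ) := by
  intro h
  have : IsIntegral (pullback (genericFibreToSpec π) (Spec.map (CommRingCat.ofHom φ.toRingHom))) :=
    GeometricallyIntegral.isIntegral_of_subsingleton (genericFibreBaseChangeToSpec π φ)
  obtain ⟨F, _, _, _, ψ, q, hq, hE⟩ := h.exists_point
  obtain ⟨d, hd⟩ := exists_derivation_ne_zero (k := k) (F := F)
  refine hd (derivation_eq_zero_of_trivialCanonicalBundle hf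
    (q ≫ pullback.fst _ _ ≫ pullback.fst _ _) (comp_fst_fst_comp_eq_SpecMap_algebraMap hq hπ)
    (fun D hD => ?_) d)
  have := isIntegrallyClosedIn_constants D
  exact eq_zero_of_constants_eq_top (hE _ (isDefinedOver_of_fst_fst hq hD))

end K3Fib

end

theorem mainTheorem6_general {k : Type u} [Field k] [CharZero k] {X : Scheme.{u}}
    (f : X ⟶ Spec (.of k)) [IsProper f] (hf : K3Fib.TrivialCanonicalBundle f)
    (π : X ⟶ K3Fib.P1 k) (hπ : π ≫ K3Fib.P1.toSpec k = f)
    (hcurve : K3Fib.IsCurve (K3Fib.genericFibreToSpec π))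
    [GeometricallyIntegral (K3Fib.genericFibreToSpec π)] (φ : RatFunc k →ₐ[k] RatFunc k) :
    K3Fib.IsCurve (K3Fib.genericFibreBaseChangeToSpec π φ) ∧
      ¬ K3Fib.IsConstant k (K3Fib.genericFibreBaseChangeToSpec π φ) :=
  ⟨hcurve.baseChange_of_finite (K3Fib.finite_ratFunc_algHom φ), K3Fib.not_isConstant hf hπ φ⟩

theorem mainTheorem6 {k : Type u} [Field k] [IsAlgClosed k] [CharZero k]
    {X : Scheme.{u}} (f : X ⟶ Spec (.of k)) (hX : K3Fib.IsK3Surface f)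
    (π : X ⟶ K3Fib.P1 k) (hπ : K3Fib.IsGenusOneFibration f π)
    (φ : RatFunc k →ₐ[k] RatFunc k) :
    K3Fib.IsCurve (K3Fib.genericFibreBaseChangeToSpec π φ) ∧
      ¬ K3Fib.IsConstant k (K3Fib.genericFibreBaseChangeToSpec π φ) := by
  have := hX.proper
  have := hπ.generic.geometricallyIntegral
  exact mainTheorem6_general f hX.trivialCanonicalBundle π hπ.comp_toSpec hπ.generic.isCurve φ
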